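/- **Proposition 4.8.** For $n\ge 1$ let $$W_n=\{\lambda\in[0,\infty)^n:\ \lambda_1+\dots+\lambda_n>0\},\qquad W_n^0=\{\lambda\in[0,\infty)^n:\ \lambda_1>0\}.$$ An *$\mathbb R$-weighted mean* on an interval $I\subseteq\mathbb R$ is a function $\mathscr M:\bigcup_{n\ge1} I^n\times W_n\to I$ such that for all $n\ge 1$, $x\in I^n$, $\lambda,\mu\in W_n$: * $\mathscr M(x,t\lambda)=\mathscr M(x,\lambda)$ for all $t>0$; * $\mathscr M(x,\lambda+\mu)=\mathscr M\big((x_1,x_1,\dots,x_n,x_n),(\lambda_1,\mu_1,\dots,\lambda_n,\mu_n)\big)$; * $\min_i x_i\le\mathscr M(x,\lambda)\le\max_i x_i$; * if $\lambda_j=0$, then $\mathscr M(x,\lambda)$ does not change when the $j$-th entry and the $j$-th weight are deleted. It is *symmetric* if $\mathscr M(x,\lambda)=\mathscr M(x\circ\sigma,\lambda\circ\sigma)$ for all permutations $\sigma$ of $\{1,\dots,n\}$, *Jensen concave* if $\mathscr M(\frac{x+y}2,\lambda)\ge\frac12\big(\mathscr M(x,\lambda)+\mathscr M(y,\lambda)\big)$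 for all $x,y\in I^n$ and $\lambda\in W_n$, and *continuous in the weights* if $\lambda\mapsto\mathscr M(x,\lambda)$ is continuous on $W_n$ for all $n$ and $x\in I^n$. Let $\mathscr A(x,\lambda)=\frac{\lambda_1x_1+\dots+\lambda_nx_n}{\lambda_1+\dots+\lambda_n}$. For $\lambda\in W_n^0$, the mean $\mathscr M$ satisfies the *$(n,\lambda)$-weighted Kedlaya inequality* if for all $x\in I^n$ $$\mathscr A\big((M_1,\dots,M_n),\lambda\big)\le\mathscr M\big((A_1,\dots,A_n),\lambda\big),$$ where $M_k=\mathscr M\big((x_1,\dots,x_k),(\lambda_1,\dots,\lambda_k)\big)$ and $A_k=\mathscr A\big((x_1,\dots,x_k),(\lambda_1,\dots,\lambda_k)\big)$. Let $\mathcal W^{\mathbb R}_n$ be the set of all $\lambda\in W_n^0$ such that every symmetric and Jensen concave $\mathbb R$-weighted mean on $(0,\infty)$ that is continuous in the weights satisfies the $(n,\lambda)$-weighted Kedlaya inequality. For $p\in\mathbb R$ let $\mathscr P_p$ be the weighted power mean on $(0,\infty)$, $$\mathscr P_p(x,\lambda)=\Big(\frac{\sum_i\lambda_ix_i^p}{\sum_i\lambda_i}\Big)^{1/p}\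 (p\ne0),\qquad \mathscr P_0(x,\lambda)=\exp\Big(\frac{\sum_i\lambda_i\ln x_i}{\sum_i\lambda_i}\Big).$$ 1. For every $p\le1$, every $n\ge1$ and every $\lambda\in\mathcal W^{\mathbb R}_n$, the mean $\mathscr P_p$ satisfies the $(n,\lambda)$-weighted Kedlaya inequality. 2. For $p=0$ this inequality is Kedlaya's weighted inequality: for every $n\ge1$ and $\lambda\in W_n^0$, with $\Lambda_k=\lambda_1+\dots+\lambda_k$, the mean $\mathscr P_0$ satisfies the $(n,\lambda)$-weighted Kedlaya inequality if and only if, for all $x_1,\dots,x_n>0$, $$\sum_{j=1}^n\frac{\lambda_j}{\Lambda_n}\prod_{i=1}^jx_i^{\lambda_i/\Lambda_j}\ \le\ \prod_{i=1}^n\Big(\sum_{j=1}^i\frac{\lambda_j}{\Lambda_i}x_j\Big)^{\lambda_i/\Lambda_n}.\qquad(*)$$ 3. (Kedlaya, 1999) If $\lambda_1,\dots,\lambda_n>0$ and $(\lambda_i/\Lambda_i)_{i=1}^n$ is nonincreasing, then $(*)$ holds for all $x_1,\dots,x_n>0$. -/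

import Mathlib

namespace Kedlaya

/-- The set `W_n(ℝ)` of `n`-dimensional weight vectors: nonnegative entries, positive sum
(so `W 0` is empty). -/
def W (n : ℕ) : Set (Fin n → ℝ) :=
  {w | (∀ i, 0 ≤ w i) ∧ 0 < ∑ i, w i}

/-- The set `W_n^0(ℝ)` of weight vectors whose first entry is positive (empty for `n = 0`). -/
def W0 (n : ℕ) : Set (Fin n → ℝ) :=
  {w | (∀ i, 0 ≤ w i) ∧ ∃ h : 0 < n, 0 < w ⟨0, h⟩}

/-- The shuffle `(p_1, q_1, p_2, q_2, …, p_n, q_n)` of two vectors of length `n`. -/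
def shuffle {n : ℕ} (p q : Fin n → ℝ) : Fin (2 * n) → ℝ := fun i =>
  if (i : ℕ) % 2 = 0 then p ⟨(i : ℕ) / 2, by omega⟩ else q ⟨(i : ℕ) / 2, by omega⟩

/-- The initial segment `(x_1, …, x_k)` of `x`, where its last index `k` is an element of `Fin n`
(counted from zero, so that the segment has length `k + 1`). -/
def initSeg {n : ℕ} (x : Fin n → ℝ) (k : Fin n) : Fin ((k : ℕ) + 1) → ℝ :=
  fun i => x (Fin.castLE k.isLt i)

/-- `M` is an `ℝ`-weighted mean on the interval `I`. The number `M n x w` is the mean of the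
entries `x` with the weights `w`; only its values at `x ∈ I^n`, `w ∈ W n` matter. -/
structure IsWeightedMean (I : Set ℝ) (M : (n : ℕ) → (Fin n → ℝ) → (Fin n → ℝ) → ℝ) : Prop where
  mem : ∀ (n : ℕ) (x w : Fin n → ℝ), (∀ i, x i ∈ I) → w ∈ W n → M n x w ∈ I
  nullhomogeneous : ∀ (n : ℕ) (x w : Fin n → ℝ) (t : ℝ), (∀ i, x i ∈ I) → w ∈ W n → 0 < t →
    M n x w = M n x (t • w)
  reduction : ∀ (n : ℕ) (x w v : Fin n → ℝ), (∀ i, x i ∈ I) → w ∈ W n → v ∈ W n →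
    M n x (w + v) = M (2 * n) (shuffle x x) (shuffle w v)
  mean_value : ∀ (n : ℕ) (x w : Fin n → ℝ), (∀ i, x i ∈ I) → w ∈ W n →
    (⨅ i, x i) ≤ M n x w ∧ M n x w ≤ ⨆ i, x i
  elimination : ∀ (n : ℕ) (x w : Fin (n + 1) → ℝ) (j : Fin (n + 1)), (∀ i, x i ∈ I) →
    w ∈ W (n + 1) → w j = 0 →
    M (n + 1) x w = M n (fun i => x (j.succAbove i)) (fun i => w (j.succAbove i))

/-- Symmetry: entries and weights may be permuted simultaneously. -/
def IsSymmetric (I : Set ℝ) (M : (n : ℕ) → (Fin n → ℝ) → (Fin n → ℝ) → ℝ) : Prop :=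
  ∀ (n : ℕ) (x w : Fin n → ℝ) (σ : Equiv.Perm (Fin n)), (∀ i, x i ∈ I) → w ∈ W n →
    M n x w = M n (x ∘ σ) (w ∘ σ)

/-- Jensen concavity in the entries. -/
def IsJensenConcave (I : Set ℝ) (M : (n : ℕ) → (Fin n → ℝ) → (Fin n → ℝ) → ℝ) : Prop :=
  ∀ (n : ℕ) (x y w : Fin n → ℝ), (∀ i, x i ∈ I) → (∀ i, y i ∈ I) → w ∈ W n →
    (M n x w + M n y w) / 2 ≤ M n (fun i => (x i + y i) / 2) w

/-- Continuity in the weights. -/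
def IsContinuousInWeights (I : Set ℝ) (M : (n : ℕ) → (Fin n → ℝ) → (Fin n → ℝ) → ℝ) : Prop :=
  ∀ (n : ℕ) (x : Fin n → ℝ), (∀ i, x i ∈ I) → ContinuousOn (fun w => M n x w) (W n)

/-- The weighted arithmetic mean. -/
noncomputable def arithMean (n : ℕ) (x w : Fin n → ℝ) : ℝ :=
  (∑ i, w i * x i) / ∑ i, w i

/-- The weighted power mean of exponent `p` (for positive entries). -/
noncomputable def powerMean (p : ℝ) (n : ℕ) (x w : Fin n → ℝ) : ℝ :=
  if p = 0 then Real.exp ((∑ i, w i * Real.log (x i)) / ∑ i, w i)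
  else ((∑ i, w i * x i ^ p) / ∑ i, w i) ^ (1 / p)

/-- The `n` variable `w`-weighted Kedlaya inequality for a mean `M` on `I`: the arithmetic mean of
the means of the initial segments is at most the mean of the arithmetic means of the initial
segments. -/
def KedlayaInequality (I : Set ℝ) (M : (n : ℕ) → (Fin n → ℝ) → (Fin n → ℝ) → ℝ)
    (n : ℕ) (w : Fin n → ℝ) : Prop :=
  ∀ x : Fin n → ℝ, (∀ i, x i ∈ I) →
    arithMean n (fun k => M ((k : ℕ) + 1) (initSeg x k) (initSeg w k)) w ≤
      M n (fun k => arithMean ((k : ℕ) + 1) (initSeg x k) (initSeg w k)) w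

/-- The set `WR_n`, taken over the domain `I`: all weight vectors `w ∈ W_n^0(ℝ)` for which every
symmetric and Jensen concave `ℝ`-weighted mean on `I` that is continuous in the weights satisfies
the `(n, w)`-weighted Kedlaya inequality. -/
def WR (I : Set ℝ) (n : ℕ) : Set (Fin n → ℝ) :=
  {w | w ∈ W0 n ∧ ∀ M : (n : ℕ) → (Fin n → ℝ) → (Fin n → ℝ) → ℝ,
    IsWeightedMean I M → IsSymmetric I M → IsJensenConcave I M → IsContinuousInWeights I M →
      KedlayaInequality I M n w}

/-- Kedlaya's weighted inequality between arithmetic and geometric means, written out: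
`∑_j (λ_j/Λ_n) ∏_{i ≤ j} x_i^(λ_i/Λ_j) ≤ ∏_i (∑_{j ≤ i} (λ_j/Λ_i) x_j)^(λ_i/Λ_n)`
with `Λ_k = λ_1 + ⋯ + λ_k`, for given weights and all positive `x`. -/
def GeometricKedlayaInequality (n : ℕ) (w : Fin n → ℝ) : Prop :=
  ∀ x : Fin n → ℝ, (∀ i, 0 < x i) →
    ∑ j, w j / (∑ l, w l) *
        ∏ i ∈ Finset.Iic j, x i ^ (w i / ∑ l ∈ Finset.Iic j, w l) ≤
      ∏ i, (∑ j ∈ Finset.Iic i, w j / (∑ l ∈ Finset.Iic i, w l) * x j) ^ (w i / ∑ l, w l)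

end Kedlaya

namespace Kedlaya

/-! The first claim only requires that power means with `p ≤ 1` qualify for the definition of `WR`.
They are quasi-arithmetic means whose generator is increasing and, for `p ≤ 1`, concave; with
homogeneity this gives Jensen concavity (`isJensenConcave_powerMean`). The second claim rewrites
products of powers as exponentials of weighted logarithms.

The third claim is proved by induction on the number of entries (`kedlaya_step`). Divide by the
geometric mean of the arithmetic means `A 0, …, A n`. Both terms on the left become exponentials of
weighted logarithms: of the ratios `A k / A (k + 1)`, by Abel summation, and of `x i / A i`.
Bounding each by the AM-GM inequality gives linear expressions whose nonconstant parts cancel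
exactly. Monotonicity of the weight ratios enters only to make the weights in the first AM-GM sum to
at most one. -/

/-! ### Power means as quasi-arithmetic means -/

/-- The strictly increasing generator of the power mean of exponent `p`. -/
noncomputable def powerGenerator (p t : ℝ) : ℝ :=
  if p = 0 then Real.log t else t ^ p / p

theorem strictMonoOn_powerGenerator (p : ℝ) :
    StrictMonoOn (powerGenerator p) (Set.Ioi 0) := by
  intro s hs t ht hst
  simp only [Set.mem_Ioi] at hs ht
  unfold powerGenerator
  split_ifs with hp
  · exact Real.log_lt_log hs hst
  · rcases lt_or_gt_of_ne hp with h | h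
    · exact (div_lt_div_right_of_neg h).2 (Real.rpow_lt_rpow_of_neg hs hst h)
    · exact div_lt_div_of_pos_right (Real.rpow_lt_rpow hs.le hst h) h

/-- Here `t ^ p = exp (p * log t)`, and `p * log t` is convex because `log` is concave and `p ≤ 0`.
-/
theorem convexOn_rpow_of_nonpos {p : ℝ} (hp : p ≤ 0) :
    ConvexOn ℝ (Set.Ioi 0) fun t : ℝ => t ^ p := by
  refine ⟨convex_Ioi 0, fun x hx y hy a b ha hb hab => ?_⟩
  have hxy : 0 < a • x + b • y := convex_Ioi (0 : ℝ) hx hy ha hb hab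
  simp only
  rw [Real.rpow_def_of_pos hxy, Real.rpow_def_of_pos hx, Real.rpow_def_of_pos hy]
  refine le_trans (Real.exp_le_exp.2 ?_)
    (convexOn_exp.2 (Set.mem_univ _) (Set.mem_univ _) ha hb hab)
  have h := mul_le_mul_of_nonpos_right (strictConcaveOn_log_Ioi.concaveOn.2 hx hy ha hb hab) hp
  simp only [smul_eq_mul] at h ⊢
  linarith

theorem concaveOn_powerGenerator {p : ℝ} (hp : p ≤ 1) :
    ConcaveOn ℝ (Set.Ioi 0) (powerGenerator p) := by
  rcases lt_trichotomy p 0 with h | rfl | h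
  · have hf : powerGenerator p = fun t => -((-p)⁻¹ • t ^ p) := by
      ext t
      simp only [powerGenerator, h.ne, if_false, smul_eq_mul]
      rw [inv_neg]; ring
    rw [hf]
    exact ((convexOn_rpow_of_nonpos h.le).smul (by rw [inv_nonneg]; linarith)).neg
  · have hf : powerGenerator 0 = Real.log := by ext t; simp [powerGenerator]
    rw [hf]
    exact strictConcaveOn_log_Ioi.concaveOn
  · have hf : powerGenerator p = fun t => p⁻¹ • t ^ p := by
      ext t
      simp only [powerGenerator, h.ne', if_false, smul_eq_mul]
      ring
    rw [hf]
    exact ((Real.concaveOn_rpow h.le hp).subset Set.Ioi_subset_Ici_self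
      (convex_Ioi 0)).smul (inv_nonneg.2 h.le)

theorem sum_weight_mul_pos {n : ℕ} {w f : Fin n → ℝ} (hw : w ∈ W n) (hf : ∀ i, 0 < f i) :
    0 < ∑ i, w i * f i := by
  obtain ⟨i, hi, hwi⟩ := Finset.exists_lt_of_sum_lt
    (s := Finset.univ) (f := fun _ : Fin n => (0 : ℝ)) (g := w) (by simpa using hw.2)
  exact Finset.sum_pos' (fun j _ => mul_nonneg (hw.1 j) (hf j).le)
    ⟨i, hi, mul_pos hwi (hf i)⟩

theorem powerMean_pos (p : ℝ) {n : ℕ} {x w : Fin n → ℝ} (hx : ∀ i, 0 < x i) (hw : w ∈ W n) :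
    0 < powerMean p n x w := by
  unfold powerMean
  split_ifs
  · exact Real.exp_pos _
  · exact Real.rpow_pos_of_pos
      (div_pos (sum_weight_mul_pos hw fun i => Real.rpow_pos_of_pos (hx i) _) hw.2) _

/-- The power mean is the quasi-arithmetic mean of its generator. -/
theorem sum_mul_powerGenerator_powerMean (p : ℝ) {n : ℕ} {x w : Fin n → ℝ}
    (hx : ∀ i, 0 < x i) (hw : w ∈ W n) :
    (∑ i, w i) * powerGenerator p (powerMean p n x w) = ∑ i, w i * powerGenerator p (x i) := by
  have hS := hw.2.ne'
  unfold powerMean powerGenerator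
  split_ifs with hp
  · rw [Real.log_exp]; field_simp
  · have h := div_pos (sum_weight_mul_pos hw fun i => Real.rpow_pos_of_pos (hx i) p) hw.2
    rw [← Real.rpow_mul h.le, one_div, inv_mul_cancel₀ hp, Real.rpow_one]
    simp only [← mul_div_assoc, ← Finset.sum_div]
    field_simp

theorem le_powerMean_iff (p : ℝ) {n : ℕ} {x w : Fin n → ℝ} (hx : ∀ i, 0 < x i) (hw : w ∈ W n)
    {c : ℝ} (hc : 0 < c) :
    c ≤ powerMean p n x w ↔
      (∑ i, w i) * powerGenerator p c ≤ ∑ i, w i * powerGenerator p (x i) := by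
  rw [← sum_mul_powerGenerator_powerMean p hx hw, mul_le_mul_iff_right₀ hw.2]
  exact ((strictMonoOn_powerGenerator p).le_iff_le hc (powerMean_pos p hx hw)).symm

theorem powerMean_le_iff (p : ℝ) {n : ℕ} {x w : Fin n → ℝ} (hx : ∀ i, 0 < x i) (hw : w ∈ W n)
    {c : ℝ} (hc : 0 < c) :
    powerMean p n x w ≤ c ↔
      ∑ i, w i * powerGenerator p (x i) ≤ (∑ i, w i) * powerGenerator p c := by
  rw [← sum_mul_powerGenerator_powerMean p hx hw, mul_le_mul_iff_right₀ hw.2]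
  exact ((strictMonoOn_powerGenerator p).le_iff_le (powerMean_pos p hx hw) hc).symm

/-! ### Power means are admissible means -/

/-- A power mean sees its data only through the weighted distribution of the entries, so reduction,
elimination and symmetry all become identities between sums. -/
theorem powerMean_congr (p : ℝ) {n m : ℕ} {x w : Fin n → ℝ} {y v : Fin m → ℝ}
    (h : ∀ f : ℝ → ℝ, ∑ i, w i * f (x i) = ∑ i, v i * f (y i)) :
    powerMean p n x w = powerMean p m y v := by
  have h1 : ∑ i, w i = ∑ i, v i := by simpa using h fun _ => 1
  unfold powerMean
  rw [h1, h Real.log, h fun t => t ^ p]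

theorem powerMean_smul_entries (p : ℝ) {n : ℕ} {x w : Fin n → ℝ} (hx : ∀ i, 0 < x i)
    (hw : w ∈ W n) {c : ℝ} (hc : 0 < c) :
    powerMean p n (fun i => c * x i) w = c * powerMean p n x w := by
  have hS := hw.2.ne'
  unfold powerMean
  split_ifs with hp
  · have h : (∑ i, w i * Real.log (c * x i)) / ∑ i, w i =
        Real.log c + (∑ i, w i * Real.log (x i)) / ∑ i, w i := by
      simp only [Real.log_mul hc.ne' (hx _).ne', mul_add, Finset.sum_add_distrib,
        ← Finset.sum_mul]
      field_simp
    rw [h, Real.exp_add, Real.exp_log hc]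
  · have h : (∑ i, w i * (c * x i) ^ p) / ∑ i, w i =
        c ^ p * ((∑ i, w i * x i ^ p) / ∑ i, w i) := by
      rw [← mul_div_assoc, Finset.mul_sum]
      congr 1
      refine Finset.sum_congr rfl fun i _ => ?_
      rw [Real.mul_rpow hc.le (hx i).le]; ring
    have h' := div_pos (sum_weight_mul_pos hw fun i => Real.rpow_pos_of_pos (hx i) p) hw.2
    rw [h, Real.mul_rpow (Real.rpow_nonneg hc.le _) h'.le, ← Real.rpow_mul hc.le,
      mul_one_div_cancel hp, Real.rpow_one]

theorem sum_shuffle {n : ℕ} (x w v : Fin n → ℝ) (f : ℝ → ℝ) :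
    ∑ i, shuffle w v i * f (shuffle x x i) = ∑ i, (w i + v i) * f (x i) := by
  induction n with
  | zero => simp
  | succ n ih =>
    have h := ih (fun i => x i.succ) (fun i => w i.succ) (fun i => v i.succ)
    rw [Fin.sum_univ_succ (n := n), ← h]
    -- Exposing two successors lets the first pair of the shuffle be split off.
    change ∑ i : Fin (2 * n + 1 + 1), _ = _
    rw [Fin.sum_univ_succ, Fin.sum_univ_succ, ← add_assoc]
    congr 1
    · have h1 : 1 % (2 * (n + 1)) = 1 := Nat.mod_eq_of_lt (by omega)
      simp [shuffle, add_mul, h1]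
    · refine Finset.sum_congr rfl fun i _ => ?_
      have h1 : ((i : ℕ) + 1 + 1) % 2 = (i : ℕ) % 2 := by omega
      have h2 : ((i : ℕ) + 1 + 1) / 2 = (i : ℕ) / 2 + 1 := by omega
      simp [shuffle, h1, h2]

theorem isWeightedMean_powerMean (p : ℝ) : IsWeightedMean (Set.Ioi 0) (powerMean p) where
  mem n x w hx hw := powerMean_pos p hx hw
  nullhomogeneous n x w t hx hw ht := by
    unfold powerMean
    simp only [Pi.smul_apply, smul_eq_mul, mul_assoc, ← Finset.mul_sum,
      mul_div_mul_left _ _ ht.ne']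
  reduction n x w v hx hw hv := powerMean_congr p fun f => (sum_shuffle x w v f).symm
  mean_value n x w hx hw := by
    have hne : Nonempty (Fin n) := by
      by_contra h
      rw [not_nonempty_iff] at h
      simpa using hw.2
    obtain ⟨a, ha⟩ := exists_eq_ciInf_of_finite (f := x)
    obtain ⟨b, hb⟩ := exists_eq_ciSup_of_finite (f := x)
    have hmono := (strictMonoOn_powerGenerator p).monotoneOn
    rw [← ha, ← hb, le_powerMean_iff p hx hw (hx a), powerMean_le_iff p hx hw (hx b),
      Finset.sum_mul, Finset.sum_mul]
    refine ⟨Finset.sum_le_sum fun i _ => mul_le_mul_of_nonneg_left ?_ (hw.1 i),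
      Finset.sum_le_sum fun i _ => mul_le_mul_of_nonneg_left ?_ (hw.1 i)⟩
    · exact hmono (hx a) (hx i) (ha ▸ ciInf_le (Set.finite_range x).bddBelow i)
    · exact hmono (hx i) (hx b) (hb ▸ le_ciSup (Set.finite_range x).bddAbove i)
  elimination n x w j hx hw hj := powerMean_congr p fun f => by
    rw [Fin.sum_univ_succAbove _ j, hj, zero_mul, zero_add]

theorem isSymmetric_powerMean (p : ℝ) : IsSymmetric (Set.Ioi 0) (powerMean p) :=
  fun _ x w σ _ _ => powerMean_congr p fun f =>
    (Equiv.sum_comp σ fun i => w i * f (x i)).symm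

theorem isContinuousInWeights_powerMean (p : ℝ) :
    IsContinuousInWeights (Set.Ioi 0) (powerMean p) := by
  intro n x hx
  have hquot (g : Fin n → ℝ) :
      ContinuousOn (fun w : Fin n → ℝ => (∑ i, w i * g i) / ∑ i, w i) (W n) :=
    ContinuousOn.div (by fun_prop) (by fun_prop) fun w hw => hw.2.ne'
  unfold powerMean
  split_ifs
  · exact (hquot _).rexp
  · exact (hquot _).rpow_const fun w hw => Or.inl (div_pos
      (sum_weight_mul_pos hw fun i => Real.rpow_pos_of_pos (hx i) p) hw.2).ne'

/-- Concavity of the generator makes the set of entries with mean at least `1` convex; homogeneity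
upgrades this to superadditivity. -/
theorem isJensenConcave_powerMean {p : ℝ} (hp : p ≤ 1) :
    IsJensenConcave (Set.Ioi 0) (powerMean p) := by
  intro n x y w hx hy hw
  have hX := powerMean_pos p hx hw
  have hY := powerMean_pos p hy hw
  set X := powerMean p n x w
  set Y := powerMean p n y w
  have hx' (i) : 0 < X⁻¹ * x i := mul_pos (inv_pos.2 hX) (hx i)
  have hy' (i) : 0 < Y⁻¹ * y i := mul_pos (inv_pos.2 hY) (hy i)
  have hX1 : powerMean p n (fun i => X⁻¹ * x i) w = 1 := by
    rw [powerMean_smul_entries p hx hw (inv_pos.2 hX), inv_mul_cancel₀ hX.ne']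
  have hY1 : powerMean p n (fun i => Y⁻¹ * y i) w = 1 := by
    rw [powerMean_smul_entries p hy hw (inv_pos.2 hY), inv_mul_cancel₀ hY.ne']
  have hXg := sum_mul_powerGenerator_powerMean p hx' hw
  have hYg := sum_mul_powerGenerator_powerMean p hy' hw
  rw [hX1] at hXg
  rw [hY1] at hYg
  -- With these coefficients, `(x + y) / (X + Y)` is a convex combination of the normalized vectors
  -- `x / X` and `y / Y`, both of mean `1`.
  set a := X / (X + Y)
  set b := Y / (X + Y)
  have ha : 0 < a := by positivity
  have hb : 0 < b := by positivity
  have hab : a + b = 1 := by simp only [a, b]; field_simp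
  have hz (i) : 0 < a * (X⁻¹ * x i) + b * (Y⁻¹ * y i) :=
    add_pos (mul_pos ha (hx' i)) (mul_pos hb (hy' i))
  have key : 1 ≤ powerMean p n (fun i => a * (X⁻¹ * x i) + b * (Y⁻¹ * y i)) w := by
    rw [le_powerMean_iff p hz hw one_pos]
    calc (∑ i, w i) * powerGenerator p 1
        = a * ((∑ i, w i) * powerGenerator p 1) + b * ((∑ i, w i) * powerGenerator p 1) := by
          rw [← add_mul, hab, one_mul]
      _ = ∑ i, w i * (a * powerGenerator p (X⁻¹ * x i) + b * powerGenerator p (Y⁻¹ * y i)) := by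
          nth_rewrite 1 [hXg]
          rw [hYg, Finset.mul_sum, Finset.mul_sum, ← Finset.sum_add_distrib]
          exact Finset.sum_congr rfl fun i _ => by ring
      _ ≤ _ := Finset.sum_le_sum fun i _ => mul_le_mul_of_nonneg_left
          ((concaveOn_powerGenerator hp).2 (hx' i) (hy' i) ha.le hb.le hab) (hw.1 i)
  have hXY : 0 < (X + Y) / 2 := by positivity
  have heq : (fun i => (x i + y i) / 2) =
      fun i => (X + Y) / 2 * (a * (X⁻¹ * x i) + b * (Y⁻¹ * y i)) := by
    ext i
    simp only [a, b]
    field_simp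
  rw [heq, powerMean_smul_entries p hz hw hXY]
  exact le_mul_of_one_le_right hXY.le key

/-! ### The geometric case in closed form -/

theorem sum_initSeg {n : ℕ} (k : Fin n) (f : Fin n → ℝ) :
    ∑ i : Fin ((k : ℕ) + 1), f (Fin.castLE k.isLt i) = ∑ i ∈ Finset.Iic k, f i := by
  refine Finset.sum_bij (fun i _ => Fin.castLE k.isLt i) ?_ ?_ ?_ ?_
  · intro i _
    simp only [Finset.mem_Iic, Fin.le_def, Fin.val_castLE]
    omega
  · intro i _ j _ h
    exact Fin.castLE_injective _ h
  · intro i hi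
    simp only [Finset.mem_Iic, Fin.le_def] at hi
    exact ⟨⟨i, by omega⟩, Finset.mem_univ _, rfl⟩
  · intro i _; rfl

theorem arithMean_initSeg {n : ℕ} (x w : Fin n → ℝ) (k : Fin n) :
    arithMean ((k : ℕ) + 1) (initSeg x k) (initSeg w k) =
      (∑ i ∈ Finset.Iic k, w i * x i) / ∑ i ∈ Finset.Iic k, w i := by
  unfold arithMean
  rw [← sum_initSeg k fun i => w i * x i, ← sum_initSeg k w]
  rfl

theorem powerMean_zero_initSeg {n : ℕ} (x w : Fin n → ℝ) (k : Fin n) :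
    powerMean 0 ((k : ℕ) + 1) (initSeg x k) (initSeg w k) =
      Real.exp ((∑ i ∈ Finset.Iic k, w i * Real.log (x i)) / ∑ i ∈ Finset.Iic k, w i) := by
  rw [powerMean, if_pos rfl, ← sum_initSeg k fun i => w i * Real.log (x i), ← sum_initSeg k w]
  rfl

theorem prod_rpow_div_eq_exp {ι : Type*} (s : Finset ι) {x : ι → ℝ} (w : ι → ℝ) (c : ℝ)
    (hx : ∀ i ∈ s, 0 < x i) :
    ∏ i ∈ s, x i ^ (w i / c) = Real.exp ((∑ i ∈ s, w i * Real.log (x i)) / c) := by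
  rw [Finset.sum_div, Real.exp_sum]
  refine Finset.prod_congr rfl fun i hi => ?_
  rw [Real.rpow_def_of_pos (hx i hi)]
  ring_nf

theorem kedlayaInequality_zero_iff {n : ℕ} {w : Fin n → ℝ} (hw : w ∈ W0 n) :
    KedlayaInequality (Set.Ioi 0) (powerMean 0) n w ↔ GeometricKedlayaInequality n w := by
  obtain ⟨hw0, hn, hpos⟩ := hw
  refine forall₂_congr fun x hx => ?_
  -- Later weights may vanish, but every initial segment contains index `0`, whose weight is
  -- positive.
  have hsum (k : Fin n) (f : Fin n → ℝ) (hf : ∀ i, 0 < f i) :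
      0 < ∑ i ∈ Finset.Iic k, w i * f i :=
    Finset.sum_pos' (fun j _ => mul_nonneg (hw0 j) (hf j).le)
      ⟨⟨0, hn⟩, by simp [Fin.le_def], mul_pos hpos (hf _)⟩
  have hA (k : Fin n) : ∑ j ∈ Finset.Iic k, w j / (∑ l ∈ Finset.Iic k, w l) * x j =
      (∑ i ∈ Finset.Iic k, w i * x i) / ∑ i ∈ Finset.Iic k, w i := by
    rw [Finset.sum_div]
    exact Finset.sum_congr rfl fun i _ => by ring
  have hApos (k : Fin n) :
      0 < (∑ i ∈ Finset.Iic k, w i * x i) / ∑ i ∈ Finset.Iic k, w i :=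
    div_pos (hsum k x hx) (by simpa using hsum k (fun _ => 1) fun _ => one_pos)
  simp only [hA, prod_rpow_div_eq_exp _ w _ fun i _ => hApos i,
    prod_rpow_div_eq_exp _ w _ fun i _ => hx i, arithMean_initSeg, powerMean_zero_initSeg]
  rw [arithMean, powerMean, if_pos rfl, Finset.sum_div]
  simp only [div_mul_eq_mul_div]

/-! ### Induction for the geometric mean -/

/-- Weighted arithmetic-geometric mean inequality, with the missing weight placed at `1`. -/
theorem exp_sum_mul_log_le {ι : Type*} (s : Finset ι) {c r : ι → ℝ} (hc : ∀ i ∈ s, 0 ≤ c i)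
    (hsum : ∑ i ∈ s, c i ≤ 1) (hr : ∀ i ∈ s, 0 < r i) :
    Real.exp (∑ i ∈ s, c i * Real.log (r i)) ≤ 1 + ∑ i ∈ s, c i * (r i - 1) := by
  have h := convexOn_exp.map_add_sum_le (t := s) (w := c) (p := fun i => Real.log (r i))
    (q := 0) (v := 1 - ∑ i ∈ s, c i) hc (by ring) (fun _ _ => Set.mem_univ _) (by linarith)
    (Set.mem_univ _)
  simp only [smul_eq_mul, mul_zero, zero_add, Real.exp_zero, mul_one] at h
  refine h.trans_eq ?_
  have he : ∑ i ∈ s, c i * Real.exp (Real.log (r i)) = ∑ i ∈ s, c i * r i :=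
    Finset.sum_congr rfl fun i hi => by rw [Real.exp_log (hr i hi)]
  rw [he]
  simp only [mul_sub, mul_one, Finset.sum_sub_distrib]
  ring

/-- Abel summation; with `a k = log (A k)` the differences are logarithms of ratios of consecutive
arithmetic means. -/
theorem sum_by_parts_log {l a : ℕ → ℝ} (n : ℕ) :
    ∑ k ∈ Finset.range n, (∑ i ∈ Finset.range (k + 1), l i) * (a k - a (k + 1)) =
      ∑ i ∈ Finset.range n, l i * a i - (∑ i ∈ Finset.range n, l i) * a n := by
  induction n with
  | zero => simp
  | succ n ih =>
    rw [Finset.sum_range_succ, ih, Finset.sum_range_succ _ n, Finset.sum_range_succ _ n]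
    ring

/-- The inductive step of the weighted Kedlaya inequality, for the partial sums `S`, the arithmetic
means `A` of the initial segments of `x` and their geometric means. -/
theorem kedlaya_step {l x S A : ℕ → ℝ} (hS : ∀ k, S k = ∑ i ∈ Finset.range k, l i)
    (hA : ∀ k, A k = (∑ i ∈ Finset.range (k + 1), l i * x i) / S (k + 1))
    (hl : ∀ i, 0 < l i) (hx : ∀ i, 0 < x i) {n : ℕ} (hn : 0 < n)
    (hmono : ∀ k < n, S (k + 1) * l n ≤ l k * S (n + 1)) :
    S n * Real.exp ((∑ i ∈ Finset.range n, l i * Real.log (A i)) / S n) +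
        l n * Real.exp ((∑ i ∈ Finset.range (n + 1), l i * Real.log (x i)) / S (n + 1)) ≤
      S (n + 1) * Real.exp ((∑ i ∈ Finset.range (n + 1), l i * Real.log (A i)) / S (n + 1)) := by
  have hSs (k) : S (k + 1) = S k + l k := by rw [hS, hS, Finset.sum_range_succ]
  have hSpos (k) : 0 < S (k + 1) := by
    rw [hS]; exact Finset.sum_pos (fun i _ => hl i) (by simp)
  have hSn : 0 < S n := by obtain ⟨m, rfl⟩ := Nat.exists_eq_succ_of_ne_zero hn.ne'; exact hSpos m
  have hApos (k) : 0 < A k := by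
    rw [hA]
    exact div_pos (Finset.sum_pos (fun i _ => mul_pos (hl i) (hx i)) (by simp)) (hSpos k)
  have hSA (k) : S (k + 1) * A k = ∑ i ∈ Finset.range (k + 1), l i * x i := by
    rw [hA, mul_div_cancel₀ _ (hSpos k).ne']
  -- The factor `l n / (S n * S (n + 1))` is `1 / S n - 1 / S (n + 1)`; the factor `S (k + 1)` comes
  -- from Abel summation.
  set c : ℕ → ℝ := fun k => S (k + 1) * l n / (S n * S (n + 1)) with hc
  set r : ℕ → ℝ := fun k => A k / A (k + 1) with hr
  have hrpos (k) : 0 < r k := div_pos (hApos _) (hApos _)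
  set R := (∑ i ∈ Finset.range (n + 1), l i * Real.log (A i)) / S (n + 1) with hR
  have e1 : (∑ i ∈ Finset.range n, l i * Real.log (A i)) / S n =
      R + ∑ k ∈ Finset.range n, c k * Real.log (r k) := by
    have h := sum_by_parts_log (l := l) (a := fun k => Real.log (A k)) n
    have h' : ∑ k ∈ Finset.range n, c k * Real.log (r k) = l n / (S n * S (n + 1)) *
        (∑ i ∈ Finset.range n, l i * Real.log (A i) - S n * Real.log (A n)) := by
      rw [hS n, ← h, Finset.mul_sum]
      refine Finset.sum_congr rfl fun k _ => ?_
      rw [hc, hr]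
      simp only
      rw [Real.log_div (hApos _).ne' (hApos _).ne', hS (k + 1), hS n]
      ring
    have := (hSpos n).ne'
    rw [h', hR, Finset.sum_range_succ]
    field_simp
    rw [hSs n]
    ring
  have e2 : (∑ i ∈ Finset.range (n + 1), l i * Real.log (x i)) / S (n + 1) =
      R + ∑ i ∈ Finset.range (n + 1), l i / S (n + 1) * Real.log (x i / A i) := by
    rw [hR, Finset.sum_div, Finset.sum_div, ← Finset.sum_add_distrib]
    refine Finset.sum_congr rfl fun i _ => ?_
    rw [Real.log_div (hx i).ne' (hApos i).ne']
    ring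
  have b1 : Real.exp (∑ k ∈ Finset.range n, c k * Real.log (r k)) ≤
      1 + ∑ k ∈ Finset.range n, c k * (r k - 1) := by
    refine exp_sum_mul_log_le _ (fun k _ => ?_) ?_ fun k _ => hrpos k
    · exact div_nonneg (mul_nonneg (hSpos k).le (hl n).le) (mul_nonneg hSn.le (hSpos n).le)
    · simp only [hc]
      rw [← Finset.sum_div, div_le_one (mul_pos hSn (hSpos n))]
      -- The only use of the monotonicity of the weight ratios.
      calc ∑ k ∈ Finset.range n, S (k + 1) * l n
          ≤ ∑ k ∈ Finset.range n, l k * S (n + 1) :=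
            Finset.sum_le_sum fun k hk => hmono k (Finset.mem_range.1 hk)
        _ = S n * S (n + 1) := by rw [← Finset.sum_mul, ← hS]
  have b2 : Real.exp (∑ i ∈ Finset.range (n + 1), l i / S (n + 1) * Real.log (x i / A i)) ≤
      1 + ∑ i ∈ Finset.range (n + 1), l i / S (n + 1) * (x i / A i - 1) := by
    refine exp_sum_mul_log_le _ (fun k _ => (div_pos (hl k) (hSpos n)).le) ?_
      fun k _ => div_pos (hx k) (hApos k)
    rw [← Finset.sum_div, ← hS, div_self (hSpos n).ne']
  -- The term `i = 0` vanishes since `A 0 = x 0`; the others follow from the recursion `S (k + 2) *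
  -- A (k + 1) = S (k + 1) * A k + l (k + 1) * x (k + 1)`.
  have e3 : ∑ i ∈ Finset.range (n + 1), l i / S (n + 1) * (x i / A i - 1) =
      -(∑ k ∈ Finset.range n, S (k + 1) * (r k - 1)) / S (n + 1) := by
    rw [Finset.sum_range_succ', ← Finset.sum_neg_distrib, Finset.sum_div]
    have h0 : A 0 = x 0 := by
      rw [hA, hS]; simp [(hl 0).ne']
    rw [h0, div_self (hx 0).ne', sub_self, mul_zero, add_zero]
    refine Finset.sum_congr rfl fun k _ => ?_
    have h1 : l (k + 1) * x (k + 1) = S (k + 1 + 1) * A (k + 1) - S (k + 1) * A k := by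
      rw [hSA, hSA, Finset.sum_range_succ _ (k + 1)]
      ring
    have h2 := (hApos (k + 1)).ne'
    have h3 : l (k + 1) * (x (k + 1) / A (k + 1) - 1) = -(S (k + 1) * (r k - 1)) := by
      have : l (k + 1) * (x (k + 1) / A (k + 1) - 1) =
          l (k + 1) * x (k + 1) / A (k + 1) - l (k + 1) := by ring
      rw [this, h1, hSs (k + 1), hr]
      field_simp
      ring
    rw [← h3]
    ring
  rw [e1, e2, Real.exp_add, Real.exp_add]
  have h4 : ∑ k ∈ Finset.range n, c k * (r k - 1) =
      l n / (S n * S (n + 1)) * ∑ k ∈ Finset.range n, S (k + 1) * (r k - 1) := by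
    rw [Finset.mul_sum]
    exact Finset.sum_congr rfl fun k _ => by simp only [hc]; ring
  rw [h4] at b1
  rw [e3] at b2
  set T := ∑ k ∈ Finset.range n, S (k + 1) * (r k - 1)
  -- The two contributions of `T` are `± l n * T / S (n + 1)`.
  have hfin : S n * (1 + l n / (S n * S (n + 1)) * T) + l n * (1 + -T / S (n + 1)) =
      S (n + 1) := by
    have := (hSpos n).ne'
    have := hSn.ne'
    rw [hSs n] at *
    field_simp
    ring
  calc _ = Real.exp R * (S n * Real.exp (∑ k ∈ Finset.range n, c k * Real.log (r k)) +
        l n * Real.exp (∑ i ∈ Finset.range (n + 1), l i / S (n + 1) * Real.log (x i / A i))) := by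
        ring
    _ ≤ Real.exp R * (S n * (1 + l n / (S n * S (n + 1)) * T) +
        l n * (1 + -T / S (n + 1))) := by
        have := hl n
        gcongr
    _ = S (n + 1) * Real.exp R := by rw [hfin, mul_comm]

theorem kedlaya_sum_le {l x S A : ℕ → ℝ} (hS : ∀ k, S k = ∑ i ∈ Finset.range k, l i)
    (hA : ∀ k, A k = (∑ i ∈ Finset.range (k + 1), l i * x i) / S (k + 1))
    (hl : ∀ i, 0 < l i) (hx : ∀ i, 0 < x i) {N : ℕ}
    (hmono : ∀ n < N, ∀ k < n, S (k + 1) * l n ≤ l k * S (n + 1)) :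
    ∑ k ∈ Finset.range N,
        l k * Real.exp ((∑ i ∈ Finset.range (k + 1), l i * Real.log (x i)) / S (k + 1)) ≤
      S N * Real.exp ((∑ i ∈ Finset.range N, l i * Real.log (A i)) / S N) := by
  induction N with
  | zero => simp [hS]
  | succ n ih =>
    rw [Finset.sum_range_succ]
    -- The inductive step divides by `S n`, which is zero for `n = 0`.
    rcases Nat.eq_zero_or_pos n with rfl | hn
    · have h0 : A 0 = x 0 := by
        rw [hA, hS]; simp [(hl 0).ne']
      simp [hS, h0]
    · exact (add_le_add_left (ih fun m hm => hmono m (hm.trans n.lt_succ_self)) _).trans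
        (kedlaya_step hS hA hl hx hn (hmono n n.lt_succ_self))

/-! ### Transfer to finite vectors -/

theorem sum_Iic_eq_sum_range {n : ℕ} (k : Fin n) (f : ℕ → ℝ) :
    ∑ i ∈ Finset.Iic k, f i = ∑ i ∈ Finset.range ((k : ℕ) + 1), f i := by
  rw [← sum_initSeg k fun i => f i, ← Fin.sum_univ_eq_sum_range]
  rfl

theorem kedlayaInequality_powerMean_zero {n : ℕ} (hn : 0 < n) {w : Fin n → ℝ}
    (hw : ∀ i, 0 < w i) (hanti : Antitone fun i : Fin n => w i / ∑ j ∈ Finset.Iic i, w j) :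
    KedlayaInequality (Set.Ioi 0) (powerMean 0) n w := by
  intro x hx
  -- Extending by `1` keeps positivity everywhere; the inequality for `N = n` involves only indices
  -- below `n`.
  obtain ⟨l, hl, rfl⟩ : ∃ l : ℕ → ℝ, (∀ i, 0 < l i) ∧ w = fun i : Fin n => l i :=
    ⟨fun i => if h : i < n then w ⟨i, h⟩ else 1, fun i => by
      dsimp only
      split_ifs
      exacts [hw _, one_pos], by ext i; simp⟩
  obtain ⟨y, hy, rfl⟩ : ∃ y : ℕ → ℝ, (∀ i, 0 < y i) ∧ x = fun i : Fin n => y i :=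
    ⟨fun i => if h : i < n then x ⟨i, h⟩ else 1, fun i => by
      dsimp only
      split_ifs
      exacts [hx _, one_pos], by ext i; simp⟩
  have hpos (k : ℕ) (hk : 0 < k) : 0 < ∑ i ∈ Finset.range k, l i :=
    Finset.sum_pos (fun i _ => hl i) (by simpa using hk.ne')
  simp only [sum_Iic_eq_sum_range _ l] at hanti
  have key := kedlaya_sum_le (N := n) (fun _ => rfl) (fun _ => rfl) hl hy fun m hm k hk => by
    have h := hanti (a := ⟨k, hk.trans hm⟩) (b := ⟨m, hm⟩) hk.le
    simp only at h
    rw [div_le_div_iff₀ (hpos _ m.succ_pos) (hpos _ k.succ_pos)] at h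
    linarith
  simp only [arithMean_initSeg, powerMean_zero_initSeg]
  simp only [sum_Iic_eq_sum_range _ l, sum_Iic_eq_sum_range _ fun i => l i * y i,
    sum_Iic_eq_sum_range _ fun i => l i * Real.log (y i)]
  rw [arithMean, powerMean, if_pos rfl, Fin.sum_univ_eq_sum_range l,
    div_le_iff₀ (hpos n hn), mul_comm (Real.exp _)]
  rw [← Fin.sum_univ_eq_sum_range, ← Fin.sum_univ_eq_sum_range (fun i => l i * Real.log _)] at key
  exact key

end Kedlaya

theorem proposition4p8 :
    (∀ p : ℝ, p ≤ 1 → ∀ (n : ℕ) (w : Fin n → ℝ), w ∈ Kedlaya.WR (Set.Ioi 0) n →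
      Kedlaya.KedlayaInequality (Set.Ioi 0) (Kedlaya.powerMean p) n w) ∧
    (∀ (n : ℕ) (w : Fin n → ℝ), w ∈ Kedlaya.W0 n →
      (Kedlaya.KedlayaInequality (Set.Ioi 0) (Kedlaya.powerMean 0) n w ↔
        Kedlaya.GeometricKedlayaInequality n w)) ∧
    (∀ (n : ℕ) (w : Fin n → ℝ), (∀ i, 0 < w i) →
      Antitone (fun i : Fin n => w i / ∑ j ∈ Finset.Iic i, w j) →
        Kedlaya.GeometricKedlayaInequality n w) := by
  refine ⟨fun p hp n w hw => hw.2 _ (Kedlaya.isWeightedMean_powerMean p)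
      (Kedlaya.isSymmetric_powerMean p) (Kedlaya.isJensenConcave_powerMean hp)
      (Kedlaya.isContinuousInWeights_powerMean p),
    fun n w hw => Kedlaya.kedlayaInequality_zero_iff hw, fun n w hw hanti => ?_⟩
  -- `W0 0` is empty, so `n = 0` is separate: the inequality reads `0 ≤ 1`.
  rcases Nat.eq_zero_or_pos n with rfl | hn
  · intro x _
    simp
  · exact (Kedlaya.kedlayaInequality_zero_iff ⟨fun i => (hw i).le, hn, hw _⟩).1
      (Kedlaya.kedlayaInequality_powerMean_zero hn hw hanti)
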